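/- **Theorem (Equivalence of base measures).** Let $\mathsf G$ be a real Lie group of finite dimension $m\ge 0$ (a smooth manifold without boundary, Hausdorff and second countable, with smooth group operations; neither compactness nor connectedness is assumed), with identity $e$ and Lie algebra $\mathfrak g=T_e\mathsf G$, and let $\langle\cdot,\cdot\rangle$ be an arbitrary inner product on $\mathfrak g$. For $g\in\mathsf G$ let $T_gL_{g^{-1}}:T_g\mathsf G\to\mathfrak g$ be the tangent map at $g$ of the left translation $L_{g^{-1}}:x\mapsto g^{-1}x$. On the $2m$-dimensional manifold $\mathsf G\times\mathfrak g\cong T\mathsf G$ let $\omega$ be the symplectic $2$-form $$\omega_{(g,\mu)}\big((v,\alpha),(w,\beta)\big)=\langle\beta,T_gL_{g^{-1}}v\rangle-\langle\alpha,T_gL_{g^{-1}}w\rangle+\big\langle\mu,[T_gL_{g^{-1}}v,\,T_gL_{g^{-1}}w]\big\rangle,$$ where $(g,\mu)\in\mathsf G\times\mathfrak g$, $v,w\in T_g\mathsf G$ and $\alpha,\beta\in\mathfrak g$, and let $\omega^m=\omega\wedge\dots\wedge\omega$ ($m$ factors; $\omega^0=1$). Then there is exactly one Borel measure $|\omega^m|$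 on $\mathsf G\times\mathfrak g$ induced by $\omega^m$, that is, a measure which in every smooth chart with coordinates $y^1,\dots,y^{2m}$ has the density $\big|\omega^m(\partial/\partial y^1,\dots,\partial/\partial y^{2m})\big|$ with respect to $\mathrm dy^1\cdots \mathrm dy^{2m}$. Moreover, for every left Haar measure $\mathrm dg$ on $\mathsf G$ and every Lebesgue measure (nonzero translation-invariant Borel measure, finite on compact sets) $\mathrm d\xi$ on $\mathfrak g$, there is a constant $c\in(0,\infty)$ such that $$\mathrm dg\otimes \mathrm d\xi=c\,|\omega^m| .$$ -/

import Mathlib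

open MeasureTheory
open scoped Manifold ContDiff NNReal ENNReal

noncomputable section

namespace LieVolume

/-! ### Exterior algebra of alternating forms -/

section Wedge

variable {V : Type*} [AddCommGroup V] [Module ℝ V]

/-- The exterior product of two real-valued alternating forms (sum over shuffles). -/
def wedge {p q : ℕ} (a : V [⋀^Fin p]→ₗ[ℝ] ℝ) (b : V [⋀^Fin q]→ₗ[ℝ] ℝ) :
    V [⋀^Fin (p + q)]→ₗ[ℝ] ℝ :=
  ((LinearMap.mul' ℝ ℝ).compAlternatingMap (a.domCoprod b)).domDomCongr finSumFinEquiv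

/-- The `k`-fold exterior power `a ∧ ⋯ ∧ a` of a `2`-form `a`. -/
def wedgePow (a : V [⋀^Fin 2]→ₗ[ℝ] ℝ) : (k : ℕ) → V [⋀^Fin (2 * k)]→ₗ[ℝ] ℝ
  | 0 => AlternatingMap.constOfIsEmpty ℝ V (Fin 0) 1
  | k + 1 => wedge (wedgePow a k) a

end Wedge

/-! ### The measure induced by a top-degree form on a manifold -/

/-- `μ` is the (Borel) measure `|Ω|` induced by the top-degree form `Ω` on the manifold `M` without
boundary: on the domain of every chart `φ` of the smooth structure, and with respect to every basis
`b` of the model space (linear coordinates `y¹, …, yⁿ`), it has density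
`|Ω (∂/∂y¹, …, ∂/∂yⁿ)|` with respect to `dy¹ ⋯ dyⁿ`. -/
def IsFormMeasure {n : ℕ} {V : Type*} [NormedAddCommGroup V] [NormedSpace ℝ V]
    [MeasurableSpace V] [BorelSpace V] {H : Type*} [TopologicalSpace H]
    (J : ModelWithCorners ℝ V H) {M : Type*} [TopologicalSpace M] [ChartedSpace H M]
    [MeasurableSpace M] (Ω : (x : M) → TangentSpace J x [⋀^Fin n]→ₗ[ℝ] ℝ) (μ : Measure M) : Prop :=
  ∀ φ ∈ IsManifold.maximalAtlas J ∞ M, ∀ b : Module.Basis (Fin n) ℝ V,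
    ∀ A : Set M, MeasurableSet A → A ⊆ φ.source →
      μ A = ∫⁻ y in φ.extend J '' A,
        ENNReal.ofReal |Ω ((φ.extend J).symm y)
          (fun i => mfderiv 𝓘(ℝ, V) J (φ.extend J).symm y (b i))| ∂b.addHaar

/-! ### The Lie algebra as a finite-dimensional normed space

In Mathlib the Lie algebra `𝔤 = T_e G` has as underlying topological vector space the model space.
It is given the norm and the Borel sets of the model space; the norm plays no role below except to
define the (norm-independent) smooth structure of the vector space `𝔤`. -/

section LieAlgebra

variable {m : ℕ} {G : Type*} [TopologicalSpace G] [ChartedSpace (EuclideanSpace ℝ (Fin m)) G]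
  [Group G]

instance : NormedAddCommGroup (GroupLieAlgebra (𝓡 m) G) :=
  inferInstanceAs (NormedAddCommGroup (EuclideanSpace ℝ (Fin m)))

instance : NormedSpace ℝ (GroupLieAlgebra (𝓡 m) G) :=
  inferInstanceAs (NormedSpace ℝ (EuclideanSpace ℝ (Fin m)))

instance : FiniteDimensional ℝ (GroupLieAlgebra (𝓡 m) G) :=
  inferInstanceAs (FiniteDimensional ℝ (EuclideanSpace ℝ (Fin m)))

instance : MeasurableSpace (GroupLieAlgebra (𝓡 m) G) :=
  inferInstanceAs (MeasurableSpace (EuclideanSpace ℝ (Fin m)))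

instance : BorelSpace (GroupLieAlgebra (𝓡 m) G) :=
  inferInstanceAs (BorelSpace (EuclideanSpace ℝ (Fin m)))

instance [LieGroup (𝓡 m) ∞ G] : LieGroup (𝓡 m) (minSmoothness ℝ 3) G := by
  rw [minSmoothness_of_isRCLikeNormedField]; infer_instance

end LieAlgebra

/-! ### The symplectic form in the left trivialization -/

section Trivialized

variable {L : Type*} [LieRing L] [LieAlgebra ℝ L]

lemma core_add_right (ip : InnerProductSpace.Core ℝ L) (x y z : L) :
    ip.inner x (y + z) = ip.inner x y + ip.inner x z := by
  rw [← ip.conj_inner_symm, ip.add_left, map_add, ip.conj_inner_symm, ip.conj_inner_symm]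

lemma core_smul_right (ip : InnerProductSpace.Core ℝ L) (r : ℝ) (x y : L) :
    ip.inner x (r • y) = r * ip.inner x y := by
  rw [← ip.conj_inner_symm, ip.smul_left, map_mul, ip.conj_inner_symm]
  simp

/-- The alternating `2`-form `((ξ, α), (η, β)) ↦ ⟨β, ξ⟩ - ⟨α, η⟩ + ⟨μ, [ξ, η]⟩` on `L × L`, where
`L` is a real Lie algebra with an inner product and `μ ∈ L`. -/
def trivializedForm (ip : InnerProductSpace.Core ℝ L) (μ : L) : (L × L) [⋀^Fin 2]→ₗ[ℝ] ℝ where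
  toFun u :=
    ip.inner (u 1).2 (u 0).1 - ip.inner (u 0).2 (u 1).1 + ip.inner μ ⁅(u 0).1, (u 1).1⁆
  map_update_add' := by
    intro _ u i x y
    fin_cases i <;>
      simp [Function.update, core_add_right, ip.add_left] <;> ring
  map_update_smul' := by
    intro _ u i r x
    fin_cases i <;>
      simp [Function.update, core_smul_right, ip.smul_left] <;> ring
  map_eq_zero_of_eq' := by
    intro u i j h hij
    have h01 : u 0 = u 1 := by
      fin_cases i <;> fin_cases j <;> simp_all
    have h0 : ip.inner μ 0 = 0 := by simpa using core_smul_right ip 0 μ 0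
    simp [h01, h0]

end Trivialized

/-! ### The symplectic form on `G × 𝔤` -/

section Symplectic

variable {m : ℕ} {G : Type*} [TopologicalSpace G] [ChartedSpace (EuclideanSpace ℝ (Fin m)) G]
  [Group G] [LieGroup (𝓡 m) ∞ G]

/-- Left trivialization: the tangent map `T_g L_{g⁻¹} : T_g G → T_e G = 𝔤`. -/
def leftTriv (g : G) : TangentSpace (𝓡 m) g →L[ℝ] GroupLieAlgebra (𝓡 m) G :=
  mfderiv (𝓡 m) (𝓡 m) (fun x : G => g⁻¹ * x) g

/-- Left trivialization of the tangent space of `G × 𝔤` at `p = (g, μ)`: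
`(v, α) ↦ (T_g L_{g⁻¹} v, α)`. -/
def leftTrivProd (p : G × GroupLieAlgebra (𝓡 m) G) :
    TangentSpace ((𝓡 m).prod 𝓘(ℝ, GroupLieAlgebra (𝓡 m) G)) p →ₗ[ℝ]
      GroupLieAlgebra (𝓡 m) G × GroupLieAlgebra (𝓡 m) G :=
  (leftTriv p.1).toLinearMap.prodMap
    (LinearMap.id : GroupLieAlgebra (𝓡 m) G →ₗ[ℝ] GroupLieAlgebra (𝓡 m) G)

/-- The symplectic `2`-form on `G × 𝔤` associated with the inner product `ip` on `𝔤`: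
`ω_{(g,μ)}((v,α),(w,β)) = ⟨β, T_g L_{g⁻¹} v⟩ - ⟨α, T_g L_{g⁻¹} w⟩
  + ⟨μ, [T_g L_{g⁻¹} v, T_g L_{g⁻¹} w]⟩`. -/
def symplecticForm (ip : InnerProductSpace.Core ℝ (GroupLieAlgebra (𝓡 m) G))
    (p : G × GroupLieAlgebra (𝓡 m) G) :
    TangentSpace ((𝓡 m).prod 𝓘(ℝ, GroupLieAlgebra (𝓡 m) G)) p [⋀^Fin 2]→ₗ[ℝ] ℝ :=
  (trivializedForm ip p.2).compLinearMap (leftTrivProd p)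

end Symplectic

end LieVolume

end

noncomputable section

namespace LieVolume

section Wedge

variable {V W : Type*} [AddCommGroup V] [Module ℝ V] [AddCommGroup W] [Module ℝ W]

lemma wedge_apply_mul_factorial {p q : ℕ} (a : V [⋀^Fin p]→ₗ[ℝ] ℝ) (b : V [⋀^Fin q]→ₗ[ℝ] ℝ)
    (v : Fin (p + q) → V) :
    ((p.factorial * q.factorial : ℕ) : ℝ) * wedge a b v =
      ∑ σ : Equiv.Perm (Fin p ⊕ Fin q), ((Equiv.Perm.sign σ : ℤ) : ℝ) *
        (a (fun i => v (finSumFinEquiv (σ (Sum.inl i)))) *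
          b (fun i => v (finSumFinEquiv (σ (Sum.inr i))))) := by
  have h := congrArg (fun f => LinearMap.mul' ℝ ℝ (f (fun i => v (finSumFinEquiv i))))
    (MultilinearMap.domCoprod_alternization_eq a b)
  simp only [Fintype.card_fin, AlternatingMap.smul_apply, map_nsmul] at h
  rw [nsmul_eq_mul] at h
  refine h.symm.trans ?_
  simp only [MultilinearMap.alternatization_apply, map_sum]
  refine Finset.sum_congr rfl fun σ _ => ?_
  rw [Units.smul_def, map_zsmul, zsmul_eq_mul]
  simp

lemma wedge_compLinearMap {p q : ℕ} (a : V [⋀^Fin p]→ₗ[ℝ] ℝ) (b : V [⋀^Fin q]→ₗ[ℝ] ℝ)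
    (f : W →ₗ[ℝ] V) :
    wedge (a.compLinearMap f) (b.compLinearMap f) = (wedge a b).compLinearMap f := by
  ext v
  have h : ((p.factorial * q.factorial : ℕ) : ℝ) ≠ 0 := by
    exact_mod_cast (Nat.mul_pos p.factorial_pos q.factorial_pos).ne'
  refine mul_left_cancel₀ h ?_
  rw [AlternatingMap.compLinearMap_apply, wedge_apply_mul_factorial, wedge_apply_mul_factorial]
  rfl

lemma wedgePow_compLinearMap (a : V [⋀^Fin 2]→ₗ[ℝ] ℝ) (f : W →ₗ[ℝ] V) (k : ℕ) :
    wedgePow (a.compLinearMap f) k = (wedgePow a k).compLinearMap f := by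
  induction k with
  | zero => ext v; simp [wedgePow]
  | succ k ih => simp only [wedgePow]; rw [ih]; exact wedge_compLinearMap _ _ _

/-- The matrix of the standard symplectic form in a basis `x₀, y₀, x₁, y₁, …`. -/
def stdSymplectic (i j : ℕ) : ℝ :=
  if i % 2 = 0 ∧ j = i + 1 then 1 else if j % 2 = 0 ∧ i = j + 1 then -1 else 0

lemma stdSymplectic_ne_zero {i j : ℕ} (h : stdSymplectic i j ≠ 0) :
    ∃ l, (i = 2 * l ∧ j = 2 * l + 1) ∨ (i = 2 * l + 1 ∧ j = 2 * l) := by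
  unfold stdSymplectic at h
  split_ifs at h with h1 h2
  · exact ⟨i / 2, by omega⟩
  · exact ⟨j / 2, by omega⟩
  · exact absurd rfl h

/-- Exchange the `l`-th and the last pair. -/
def pairSwap (k : ℕ) (l : Fin (k + 1)) : Equiv.Perm (Fin (2 * k + 2)) :=
  Equiv.swap ⟨2 * l, by omega⟩ ⟨2 * k, by omega⟩ *
    Equiv.swap ⟨2 * l + 1, by omega⟩ ⟨2 * k + 1, by omega⟩

lemma sign_pairSwap (k : ℕ) (l : Fin (k + 1)) : Equiv.Perm.sign (pairSwap k l) = 1 := by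
  by_cases h : (l : ℕ) = k
  · simp [pairSwap, h]
  · rw [pairSwap, Equiv.Perm.sign_mul, Equiv.Perm.sign_swap, Equiv.Perm.sign_swap] <;> simp [h]

lemma pairSwap_val (k : ℕ) (l : Fin (k + 1)) (i : Fin (2 * k + 2)) :
    (pairSwap k l i : ℕ) = if (i : ℕ) = 2 * l then 2 * k else if (i : ℕ) = 2 * l + 1 then 2 * k + 1
      else if (i : ℕ) = 2 * k then 2 * l else if (i : ℕ) = 2 * k + 1 then 2 * (l : ℕ) + 1 else i := by
  simp only [pairSwap, Equiv.Perm.mul_apply, Equiv.swap_apply_def, Fin.ext_iff]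
  split_ifs <;> simp_all <;> omega

lemma stdSymplectic_pairSwap (k : ℕ) (l : Fin (k + 1)) (i j : Fin (2 * k + 2)) :
    stdSymplectic (pairSwap k l i) (pairSwap k l j) = stdSymplectic i j := by
  have hi := pairSwap_val k l i
  have hj := pairSwap_val k l j
  unfold stdSymplectic
  congr 1
  · apply propext; split_ifs at hi hj <;> omega
  · congr 1
    apply propext; split_ifs at hi hj <;> omega

lemma pairSwap_involutive (k : ℕ) (l : Fin (k + 1)) (i : Fin (2 * k + 2)) :
    pairSwap k l (pairSwap k l i) = i := by
  apply Fin.ext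
  have hi := pairSwap_val k l i
  have hj := pairSwap_val k l (pairSwap k l i)
  split_ifs at hi hj <;> omega

/-- The powers of a `2`-form are positive on Darboux families. -/
theorem wedgePow_pos (a : V [⋀^Fin 2]→ₗ[ℝ] ℝ) (k : ℕ) (v : Fin (2 * k) → V)
    (hv : ∀ i j, a ![v i, v j] = stdSymplectic i j) : 0 < wedgePow a k v := by
  induction k with
  | zero => simp [wedgePow]
  | succ k ih =>
    change 0 < wedge (wedgePow a k) a v
    have hf : (0 : ℝ) < (((2 * k).factorial * (2).factorial : ℕ) : ℝ) := by
      exact_mod_cast Nat.mul_pos (Nat.factorial_pos _) (Nat.factorial_pos _)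
    refine pos_of_mul_pos_right (b := wedge (wedgePow a k) a v) ?_ hf.le
    rw [wedge_apply_mul_factorial]
    have key : ∀ (w : Fin (2 * k + 2) → V), (∀ i j, a ![w i, w j] = stdSymplectic i j) →
        ∀ ρ : Equiv.Perm (Fin (2 * k)), ∀ τ : Equiv.Perm (Fin 2),
        0 < ((Equiv.Perm.sign (Equiv.Perm.sumCongr ρ τ) : ℤ) : ℝ) *
          (wedgePow a k (fun i => w (finSumFinEquiv (Equiv.Perm.sumCongr ρ τ (Sum.inl i)))) *
          a (fun i => w (finSumFinEquiv (Equiv.Perm.sumCongr ρ τ (Sum.inr i))))) := by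
      intro w hw ρ τ
      have h1 := (wedgePow a k).map_perm (fun i => w (finSumFinEquiv (Sum.inl i))) ρ
      have h2 := a.map_perm (fun i => w (finSumFinEquiv (Sum.inr i))) τ
      have h3 : 0 < wedgePow a k (fun i => w (finSumFinEquiv (Sum.inl i))) := by
        apply ih
        intro i j
        rw [hw]; simp
      have h4 : a (fun i => w (finSumFinEquiv (Sum.inr i))) = 1 := by
        have : (fun i : Fin 2 => w (finSumFinEquiv (Sum.inr i))) =
            ![w ⟨2 * k, by omega⟩, w ⟨2 * k + 1, by omega⟩] := by
          funext i; fin_cases i <;> rfl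
        rw [this, hw]; simp [stdSymplectic]
      simp only [Equiv.Perm.sumCongr_apply, Sum.map_inl, Sum.map_inr]
      simp only [Function.comp_def] at h1 h2
      rw [h1, h2, h4, Equiv.Perm.sign_sumCongr]
      rcases Int.units_eq_one_or (Equiv.Perm.sign ρ) with h | h <;>
      rcases Int.units_eq_one_or (Equiv.Perm.sign τ) with h' | h' <;> simpa [h, h'] using h3
    refine Finset.sum_pos' (fun σ _ => ?_) ⟨1, Finset.mem_univ _, ?_⟩
    · by_cases h0 : a (fun i => v (finSumFinEquiv (σ (Sum.inr i)))) = 0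
      · simp [h0]
      have hvec : (fun i : Fin 2 => v (finSumFinEquiv (σ (Sum.inr i)))) =
          ![v (finSumFinEquiv (σ (Sum.inr 0))), v (finSumFinEquiv (σ (Sum.inr 1)))] := by
        funext i; fin_cases i <;> rfl
      rw [hvec, hv] at h0
      obtain ⟨l, hl⟩ := stdSymplectic_ne_zero h0
      have hlk : l < k + 1 := by
        have := (finSumFinEquiv (σ (Sum.inr 0))).2
        have := (finSumFinEquiv (σ (Sum.inr 1))).2
        omega
      set d := pairSwap k ⟨l, hlk⟩ with hd
      set d' : Equiv.Perm (Fin (2 * k) ⊕ Fin 2) := finSumFinEquiv.symm.permCongr d with hd'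
      have hmem : d' * σ ∈ (Equiv.Perm.sumCongrHom (Fin (2 * k)) (Fin 2)).range := by
        apply Equiv.Perm.mem_sumCongrHom_range_of_perm_mapsTo_inl
        have hr : ∀ s : Fin 2, ∃ t : Fin 2, (d' * σ) (Sum.inr t) = Sum.inr s := by
          have e : ∀ t s : Fin 2, (d (finSumFinEquiv (σ (Sum.inr t))) : ℕ) = 2 * k + s →
              (d' * σ) (Sum.inr t) = Sum.inr s := by
            intro t s h
            rw [Equiv.Perm.mul_apply, hd', Equiv.permCongr_apply, Equiv.symm_symm,
              Equiv.symm_apply_eq]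
            apply Fin.ext
            rw [h]; simp
          have v0 := pairSwap_val k ⟨l, hlk⟩ (finSumFinEquiv (σ (Sum.inr 0)))
          have v1 := pairSwap_val k ⟨l, hlk⟩ (finSumFinEquiv (σ (Sum.inr 1)))
          rw [← hd] at v0 v1
          simp only at v0 v1
          intro s
          rcases hl with ⟨ha, hb⟩ | ⟨ha, hb⟩
          · refine ⟨s, e _ _ ?_⟩
            fin_cases s
            · refine v0.trans ?_; rw [ha]; simp
            · refine v1.trans ?_; rw [hb]; simp
          · fin_cases s
            · refine ⟨1, e _ _ ?_⟩
              refine v1.trans ?_; rw [hb]; simp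
            · refine ⟨0, e _ _ ?_⟩
              refine v0.trans ?_; rw [ha]; simp
        rintro _ ⟨i, rfl⟩
        rcases hx : (d' * σ) (Sum.inl i) with j | s
        · exact ⟨j, rfl⟩
        · obtain ⟨t, ht⟩ := hr s
          rw [← ht] at hx
          exact absurd ((d' * σ).injective hx) (by simp)
      obtain ⟨⟨ρ, τ⟩, hρ⟩ := hmem
      have hσ : ∀ x, v (finSumFinEquiv (σ x)) =
          (v ∘ d) (finSumFinEquiv (Equiv.Perm.sumCongr ρ τ x)) := by
        intro x
        have h1 : Equiv.Perm.sumCongr ρ τ x = finSumFinEquiv.symm (d (finSumFinEquiv (σ x))) :=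
          congrArg (fun f => f x) hρ
        rw [h1]
        simp [hd, pairSwap_involutive]
      have hs : Equiv.Perm.sign σ = Equiv.Perm.sign (Equiv.Perm.sumCongr ρ τ) := by
        have h1 : Equiv.Perm.sign (Equiv.Perm.sumCongr ρ τ) = Equiv.Perm.sign (d' * σ) :=
          congrArg _ hρ
        rw [h1, Equiv.Perm.sign_mul, hd', Equiv.Perm.sign_permCongr, hd, sign_pairSwap, one_mul]
      simp only [hσ, hs]
      refine (key (v ∘ d) (fun i j => ?_) ρ τ).le
      simp only [Function.comp]
      rw [hv, hd, stdSymplectic_pairSwap]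
    · have := key v hv 1 1
      rwa [show Equiv.Perm.sumCongr (1 : Equiv.Perm (Fin (2 * k))) (1 : Equiv.Perm (Fin 2)) = 1 from
        Equiv.Perm.sumCongr_one] at this

end Wedge

section Trivialized

variable {L : Type*} [LieRing L] [LieAlgebra ℝ L]

lemma trivializedForm_apply (ip : InnerProductSpace.Core ℝ L) (μ : L) (u : Fin 2 → L × L) :
    trivializedForm ip μ u =
      ip.inner (u 1).2 (u 0).1 - ip.inner (u 0).2 (u 1).1 + ip.inner μ ⁅(u 0).1, (u 1).1⁆ :=
  rfl

lemma core_inner_zero_left (ip : InnerProductSpace.Core ℝ L) (x : L) : ip.inner 0 x = 0 := by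
  simpa using ip.smul_left 0 x 0

lemma core_inner_zero_right (ip : InnerProductSpace.Core ℝ L) (x : L) : ip.inner x 0 = 0 := by
  simpa using core_smul_right ip 0 x 0

/-- The identification of a Euclidean Lie algebra with its dual. -/
def coreToDual [FiniteDimensional ℝ L] (ip : InnerProductSpace.Core ℝ L) :
    L ≃ₗ[ℝ] Module.Dual ℝ L :=
  LinearEquiv.ofInjectiveOfFinrankEq
    (LinearMap.mk₂ ℝ ip.inner (fun x y z => ip.add_left x y z)
      (fun r x y => by simpa using ip.smul_left x y r)
      (fun x y z => core_add_right ip x y z) (fun r x y => core_smul_right ip r x y))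
    (by
      rw [injective_iff_map_eq_zero]
      intro x hx
      exact ip.definite x (by simpa using congrArg (fun f => f x) hx))
    Subspace.dual_finrank_eq.symm

lemma coreToDual_apply [FiniteDimensional ℝ L] (ip : InnerProductSpace.Core ℝ L) (x y : L) :
    coreToDual ip x y = ip.inner x y := rfl

lemma core_inner_coreToDual_symm [FiniteDimensional ℝ L] (ip : InnerProductSpace.Core ℝ L)
    (f : Module.Dual ℝ L) (y : L) : ip.inner ((coreToDual ip).symm f) y = f y := by
  rw [← coreToDual_apply, LinearEquiv.apply_symm_apply]

/-- The shear `(ξ, α) ↦ (ξ, α + T ξ)`. -/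
def shear (T : L →ₗ[ℝ] L) : L × L →ₗ[ℝ] L × L :=
  (LinearMap.fst ℝ L L).prod (LinearMap.snd ℝ L L + T ∘ₗ LinearMap.fst ℝ L L)

lemma abs_det_shear (T : L →ₗ[ℝ] L) : |LinearMap.det (shear T)| = 1 := by
  set D : L × L →ₗ[ℝ] L × L := (LinearMap.fst ℝ L L).prod (-LinearMap.snd ℝ L L)
  have h1 : D ∘ₗ D = LinearMap.id := by ext x <;> simp [D]
  have h2 : (D ∘ₗ shear T ∘ₗ D) ∘ₗ shear T = LinearMap.id := by ext x <;> simp [D, shear]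
  have h1' := congrArg LinearMap.det h1
  have h2' := congrArg LinearMap.det h2
  simp only [LinearMap.det_comp, LinearMap.det_id] at h1' h2'
  have h3 : LinearMap.det (shear T) * LinearMap.det (shear T) = 1 := by
    linear_combination h2' - LinearMap.det (shear T) * LinearMap.det (shear T) * h1'
  rcases mul_self_eq_one_iff.mp h3 with h | h <;> simp [h]

lemma alternatingMap_comp_linearMap {V ι : Type*} [AddCommGroup V] [Module ℝ V] [Fintype ι]
    [DecidableEq ι] (b : Module.Basis ι ℝ V) (a : V [⋀^ι]→ₗ[ℝ] ℝ) (f : V →ₗ[ℝ] V)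
    (v : ι → V) : a (fun i => f (v i)) = LinearMap.det f * a v := by
  rw [a.eq_smul_basis_det b, AlternatingMap.smul_apply, AlternatingMap.smul_apply,
    show (fun i => f (v i)) = f ∘ v from rfl, Module.Basis.det_comp]
  simp only [smul_eq_mul]; ring

variable [FiniteDimensional ℝ L]

/-- The half of the adjoint of `ad`, used to shear away the curvature term. -/
def halfCoadjoint (ip : InnerProductSpace.Core ℝ L) (μ : L) : L →ₗ[ℝ] L :=
  (coreToDual ip).symm.toLinearMap ∘ₗ
    LinearMap.mk₂ ℝ (fun η ξ => (1 / 2 : ℝ) * ip.inner μ ⁅ξ, η⁆)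
      (fun x y z => by rw [lie_add, core_add_right]; ring)
      (fun r x y => by rw [lie_smul, core_smul_right]; simp only [smul_eq_mul]; ring)
      (fun x y z => by rw [add_lie, core_add_right]; ring)
      (fun r x y => by rw [smul_lie, core_smul_right]; simp only [smul_eq_mul]; ring)

lemma trivializedForm_eq_comp_shear (ip : InnerProductSpace.Core ℝ L) (μ : L) :
    trivializedForm ip μ =
      (trivializedForm ip 0).compLinearMap (shear (halfCoadjoint ip μ)) := by
  have hT : ∀ x y, ip.inner (halfCoadjoint ip μ x) y = (1 / 2 : ℝ) * ip.inner μ ⁅y, x⁆ :=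
    fun x y => core_inner_coreToDual_symm ip _ y
  have hneg : ∀ x y : L, ip.inner μ ⁅y, x⁆ = - ip.inner μ ⁅x, y⁆ := by
    intro x y
    rw [← lie_skew x y]
    have := core_smul_right ip (-1) μ ⁅x, y⁆
    simpa using this
  ext u
  rw [AlternatingMap.compLinearMap_apply, trivializedForm_apply, trivializedForm_apply]
  have hs : ∀ x : L × L,
      shear (halfCoadjoint ip μ) x = (x.1, x.2 + halfCoadjoint ip μ x.1) := fun _ => rfl
  simp only [hs, ip.add_left, hT, core_inner_zero_left]
  rw [hneg (u 0).1 (u 1).1]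
  ring

/-- The Liouville volume in the left trivialization does not depend on the fibre coordinate. -/
lemma abs_wedgePow_trivializedForm (ip : InnerProductSpace.Core ℝ L) (μ : L) {m : ℕ}
    (hm : Module.finrank ℝ L = m) (v : Fin (2 * m) → L × L) :
    |wedgePow (trivializedForm ip μ) m v| = |wedgePow (trivializedForm ip 0) m v| := by
  have b : Module.Basis (Fin (2 * m)) ℝ (L × L) :=
    Module.finBasisOfFinrankEq ℝ (L × L) (by rw [Module.finrank_prod, hm]; ring)
  rw [trivializedForm_eq_comp_shear, wedgePow_compLinearMap, AlternatingMap.compLinearMap_apply,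
    alternatingMap_comp_linearMap b, abs_mul, abs_det_shear, one_mul]

/-- The Liouville volume in the left trivialization is not zero. -/
lemma wedgePow_trivializedForm_ne_zero (ip : InnerProductSpace.Core ℝ L) {m : ℕ}
    (hm : Module.finrank ℝ L = m) : wedgePow (trivializedForm ip 0) m ≠ 0 := by
  have b : Module.Basis (Fin m) ℝ L := Module.finBasisOfFinrankEq ℝ L hm
  set b' : Fin m → L := fun i => (coreToDual ip).symm (b.coord i)
  have hb : ∀ i j, ip.inner (b' i) (b j) = if i = j then 1 else 0 := by
    intro i j
    rw [core_inner_coreToDual_symm, Module.Basis.coord_apply, Module.Basis.repr_self,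
      Finsupp.single_apply]
    simp [eq_comm]
  let v : Fin (2 * m) → L × L := fun i =>
    if (i : ℕ) % 2 = 0 then (b ⟨i / 2, by omega⟩, 0) else (0, b' ⟨i / 2, by omega⟩)
  have h := wedgePow_pos (trivializedForm ip 0) m v (by
    intro i j
    rw [trivializedForm_apply]
    simp only [Matrix.cons_val_zero, Matrix.cons_val_one, core_inner_zero_left, add_zero]
    by_cases hi : (i : ℕ) % 2 = 0 <;> by_cases hj : (j : ℕ) % 2 = 0 <;>
      simp only [v, hi, hj, if_true, if_false, core_inner_zero_left, core_inner_zero_right, hb,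
        Fin.mk.injEq, sub_zero, zero_sub, stdSymplectic, true_and, false_and] <;>
      split_ifs <;> first | omega | simp)
  intro h0
  rw [h0] at h
  simp at h

end Trivialized

section FormMeasure

/-- Two measures that agree on the small measurable sets are equal. -/
lemma measure_ext_of_nhds {M : Type*} [TopologicalSpace M] [SecondCountableTopology M]
    [MeasurableSpace M] [OpensMeasurableSpace M] {μ ν : Measure M}
    (h : ∀ x, ∃ U : Set M, IsOpen U ∧ x ∈ U ∧ ∀ A, MeasurableSet A → A ⊆ U → μ A = ν A) :
    μ = ν := by
  choose U hU hx hA using h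
  obtain ⟨s, hs, hsU⟩ := TopologicalSpace.countable_cover_nhds
    (f := U) (fun x => (hU x).mem_nhds (hx x))
  have := hs.to_subtype
  rw [Measure.ext_iff_of_iUnion_eq_univ (ι := s) (s := fun x => U x) (by
    rw [← hsU, Set.biUnion_eq_iUnion])]
  intro x
  ext A hAm
  rw [Measure.restrict_apply hAm, Measure.restrict_apply hAm]
  exact hA x _ (hAm.inter (hU x).measurableSet) Set.inter_subset_right

lemma addHaar_basis_eq_smul {n : ℕ} {V : Type*} [NormedAddCommGroup V] [NormedSpace ℝ V]
    [MeasurableSpace V] [BorelSpace V] (b b' : Module.Basis (Fin n) ℝ V) :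
    b'.addHaar = ENNReal.ofReal |b'.det b| • b.addHaar := by
  have : FiniteDimensional ℝ V := b.finiteDimensional_of_finite
  have : ProperSpace V := FiniteDimensional.proper_real V
  have h := Measure.isAddLeftInvariant_eq_smul b'.addHaar b.addHaar
  have h1 := Measure.addHaar_parallelepiped b' b
  rw [h, Measure.smul_apply, b.addHaar_self] at h1
  rw [ENNReal.smul_def, smul_eq_mul, mul_one] at h1
  rw [← h1]
  exact h

variable {n : ℕ} {V : Type*} [NormedAddCommGroup V] [NormedSpace ℝ V]
    [MeasurableSpace V] [BorelSpace V] {H : Type*} [TopologicalSpace H]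
    {J : ModelWithCorners ℝ V H} {M : Type*} [TopologicalSpace M] [ChartedSpace H M]

/-- The density of `|Ω|` in the chart `φ` with the linear coordinates given by `b`. -/
def formDensity (Ω : (x : M) → TangentSpace J x [⋀^Fin n]→ₗ[ℝ] ℝ)
    (φ : OpenPartialHomeomorph M H) (b : Fin n → V) (y : V) : ℝ≥0∞ :=
  ENNReal.ofReal |Ω ((φ.extend J).symm y)
    (fun i => mfderiv 𝓘(ℝ, V) J (φ.extend J).symm y (b i))|

lemma formDensity_eq (Ω : (x : M) → TangentSpace J x [⋀^Fin n]→ₗ[ℝ] ℝ)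
    (φ : OpenPartialHomeomorph M H) (b : Fin n → V) {x : M} {y : V}
    (h : (φ.extend J).symm y = x) :
    formDensity Ω φ b y = ENNReal.ofReal |Ω x
      (fun i => (mfderiv 𝓘(ℝ, V) J (φ.extend J).symm y : V →L[ℝ] V) (b i))| := by
  subst h; rfl

/-- The `|Ω|`-volume of a subset of the domain of a chart, computed in this chart. -/
def chartVolume (Ω : (x : M) → TangentSpace J x [⋀^Fin n]→ₗ[ℝ] ℝ)
    (φ : OpenPartialHomeomorph M H) (b : Module.Basis (Fin n) ℝ V) (A : Set M) : ℝ≥0∞ :=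
  ∫⁻ y in φ.extend J '' A, formDensity Ω φ b y ∂b.addHaar

lemma chartVolume_basis (Ω : (x : M) → TangentSpace J x [⋀^Fin n]→ₗ[ℝ] ℝ)
    (φ : OpenPartialHomeomorph M H) (b b' : Module.Basis (Fin n) ℝ V) (A : Set M) :
    chartVolume Ω φ b A = chartVolume Ω φ b' A := by
  unfold chartVolume
  rw [addHaar_basis_eq_smul b b', Measure.restrict_smul, lintegral_smul_measure, smul_eq_mul,
    ← lintegral_const_mul' _ _ ENNReal.ofReal_ne_top]
  congr 1
  funext y
  unfold formDensity
  rw [← ENNReal.ofReal_mul (abs_nonneg _), ← abs_mul]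
  congr 2
  have h := AlternatingMap.eq_smul_basis_det b' ((Ω ((φ.extend J).symm y)).compLinearMap
    (mfderiv 𝓘(ℝ, V) J (φ.extend J).symm y).toLinearMap)
  have h' := congrArg (fun f => f b) h
  refine h'.trans ?_
  rw [mul_comm]
  rfl

lemma measurableSet_extend_image [J.Boundaryless] [MeasurableSpace M] [BorelSpace M]
    (φ : OpenPartialHomeomorph M H) {A : Set M} (hA : MeasurableSet A) (hAs : A ⊆ φ.source) :
    MeasurableSet (φ.extend J '' A) := by
  have hs : A ⊆ (φ.extend J).source := by rwa [φ.extend_source]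
  rw [(φ.extend J).image_eq_target_inter_inv_preimage hs]
  have hc := (continuousOn_iff_continuous_domRestrict.1 (φ.continuousOn_extend_symm (I := J)))
  have := (φ.isOpen_extend_target (I := J)).measurableSet.subtype_image (hc.measurable hA)
  convert! this using 1
  ext y
  simp
  tauto

lemma mdifferentiableAt_extend [IsManifold J ∞ M] {φ : OpenPartialHomeomorph M H}
    (hφ : φ ∈ IsManifold.maximalAtlas J ∞ M) {x : M} (hx : x ∈ φ.source) :
    MDifferentiableAt J 𝓘(ℝ, V) (φ.extend J) x := by
  have h := (contMDiffOn_of_mem_maximalAtlas hφ).contMDiffAt (φ.open_source.mem_nhds hx)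
  have h1 := h.mdifferentiableAt (by simp)
  exact (J.contMDiff.contMDiffAt.mdifferentiableAt (n := ∞) (by simp)).comp x h1

lemma mdifferentiableAt_extend_symm [J.Boundaryless] [IsManifold J ∞ M]
    {φ : OpenPartialHomeomorph M H}
    (hφ : φ ∈ IsManifold.maximalAtlas J ∞ M) {y : V} (hy : y ∈ (φ.extend J).target) :
    MDifferentiableAt 𝓘(ℝ, V) J (φ.extend J).symm y := by
  have h := contMDiffOn_extend_symm hφ
  rw [← φ.extend_target'] at h
  exact (h.contMDiffAt ((φ.isOpen_extend_target).mem_nhds hy)).mdifferentiableAt (by simp)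

lemma mfderiv_extend_symm_comp [J.Boundaryless] [IsManifold J ∞ M]
    {φ : OpenPartialHomeomorph M H}
    (hφ : φ ∈ IsManifold.maximalAtlas J ∞ M) {x : M} (hx : x ∈ φ.source) :
    (mfderiv 𝓘(ℝ, V) J (φ.extend J).symm (φ.extend J x) : V →L[ℝ] V) ∘L
      (mfderiv J 𝓘(ℝ, V) (φ.extend J) x : V →L[ℝ] V) = ContinuousLinearMap.id ℝ V := by
  have hx' : x ∈ (φ.extend J).source := by rwa [φ.extend_source]
  have h := mfderiv_comp x (mdifferentiableAt_extend_symm hφ ((φ.extend J).map_source hx'))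
    (mdifferentiableAt_extend hφ hx)
  refine h.symm.trans ?_
  have he : (φ.extend J).symm ∘ (φ.extend J) =ᶠ[nhds x] id := by
    filter_upwards [φ.open_source.mem_nhds hx] with z hz
    exact φ.extend_left_inv hz
  rw [he.mfderiv_eq]
  exact mfderiv_id

/-- Change of variables: a map that preserves `|Ω|` preserves the volume. -/
theorem chartVolume_image [J.Boundaryless] [IsManifold J ∞ M] [MeasurableSpace M] [BorelSpace M]
    (Ω : (x : M) → TangentSpace J x [⋀^Fin n]→ₗ[ℝ] ℝ)
    {φ φ' : OpenPartialHomeomorph M H} (hφ : φ ∈ IsManifold.maximalAtlas J ∞ M)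
    (hφ' : φ' ∈ IsManifold.maximalAtlas J ∞ M) (b b' : Module.Basis (Fin n) ℝ V)
    {F : M → M} (hF : MDifferentiable J J F) (hinj : Function.Injective F)
    (hΩ : ∀ (x : M) (v : Fin n → TangentSpace J x),
      |Ω (F x) (fun i => mfderiv J J F x (v i))| = |Ω x v|)
    {A : Set M} (hA : MeasurableSet A) (hAs : A ⊆ φ.source) (hAs' : F '' A ⊆ φ'.source) :
    chartVolume Ω φ' b' (F '' A) = chartVolume Ω φ b A := by
  have : FiniteDimensional ℝ V := b.finiteDimensional_of_finite
  rw [chartVolume_basis Ω φ b b']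
  unfold chartVolume
  set e := φ.extend J with he
  set e' := φ'.extend J with he'
  set T : V → V := fun y => e' (F (e.symm y)) with hT
  have himg : e' '' (F '' A) = T '' (e '' A) := by
    simp only [Set.image_image, hT]
    refine Set.image_congr fun x hx => ?_
    rw [he, φ.extend_left_inv (hAs hx)]
  let T' : V → V →L[ℝ] V := fun y => mfderiv 𝓘(ℝ, V) 𝓘(ℝ, V) T y
  have hcomp : ∀ x ∈ A, HasMFDerivAt 𝓘(ℝ, V) 𝓘(ℝ, V) T (e x)
      ((mfderiv J 𝓘(ℝ, V) e' (F x) : V →L[ℝ] V) ∘L ((mfderiv J J F x : V →L[ℝ] V) ∘L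
        (mfderiv 𝓘(ℝ, V) J e.symm (e x) : V →L[ℝ] V))) := by
    intro x hx
    have hl : e.symm (e x) = x := φ.extend_left_inv (hAs hx)
    have hx' : x ∈ e.source := by rw [he, φ.extend_source]; exact hAs hx
    have h1 := (mdifferentiableAt_extend_symm hφ (e.map_source hx')).hasMFDerivAt
    have h2 := (hF x).hasMFDerivAt
    have h3 := (mdifferentiableAt_extend hφ' (hAs' ⟨x, hx, rfl⟩)).hasMFDerivAt
    rw [← he'] at h3
    have h32 := h3.comp x h2
    rw [← hl] at h32
    have := h32.comp (e x) h1
    rw [hl] at this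
    exact this
  rw [himg, lintegral_image_eq_lintegral_abs_det_fderiv_mul b'.addHaar
    (measurableSet_extend_image φ hA hAs) (f' := T')]
  · refine setLIntegral_congr_fun (measurableSet_extend_image φ hA hAs) ?_
    rintro _ ⟨x, hx, rfl⟩
    have hl : e.symm (e x) = x := φ.extend_left_inv (hAs hx)
    have hFx : F x ∈ φ'.source := hAs' ⟨x, hx, rfl⟩
    have hTx : T (e x) = e' (F x) := by rw [hT]; simp only [hl]
    have hl' : e'.symm (T (e x)) = F x := by rw [hTx]; exact φ'.extend_left_inv hFx
    simp only
    rw [formDensity_eq Ω φ b' hl, formDensity_eq Ω φ' b' hl']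
    refine Eq.trans ?_ (congrArg ENNReal.ofReal (hΩ x (fun i =>
      (mfderiv 𝓘(ℝ, V) J (φ.extend J).symm (e x) : V →L[ℝ] V) (b' i))))
    rw [← ENNReal.ofReal_mul (abs_nonneg _), ← abs_mul]
    congr 2
    have hdet := alternatingMap_comp_linearMap b' ((Ω (F x)).compLinearMap
      (mfderiv 𝓘(ℝ, V) J (φ'.extend J).symm (T (e x)) : V →L[ℝ] V).toLinearMap)
      (T' (e x)).toLinearMap b'
    refine hdet.symm.trans ?_
    refine congrArg (Ω (F x)) (funext fun i => ?_)
    have h1 : T' (e x) = _ := (hcomp x hx).mfderiv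
    have h2 := mfderiv_extend_symm_comp hφ' hFx
    rw [hTx, h1]
    exact congrArg (fun f : V →L[ℝ] V => f _) h2
  · rintro _ ⟨x, hx, rfl⟩
    have h := hcomp x hx
    have h1 : T' (e x) = _ := h.mfderiv
    rw [h1]
    exact (hasMFDerivAt_iff_hasFDerivAt.1 h).hasFDerivWithinAt
  · rintro _ ⟨x, hx, rfl⟩ _ ⟨z, hz, rfl⟩ hxz
    have hl : e.symm (e x) = x := φ.extend_left_inv (hAs hx)
    have hlz : e.symm (e z) = z := φ.extend_left_inv (hAs hz)
    have hxz : e' (F (e.symm (e x))) = e' (F (e.symm (e z))) := hxz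
    rw [hl, hlz] at hxz
    have h1 : F x ∈ e'.source := by rw [he', φ'.extend_source]; exact hAs' ⟨x, hx, rfl⟩
    have h2 : F z ∈ e'.source := by rw [he', φ'.extend_source]; exact hAs' ⟨z, hz, rfl⟩
    rw [hinj (e'.injOn h1 h2 hxz)]

lemma chartVolume_eq [J.Boundaryless] [IsManifold J ∞ M] [MeasurableSpace M] [BorelSpace M]
    (Ω : (x : M) → TangentSpace J x [⋀^Fin n]→ₗ[ℝ] ℝ)
    {φ φ' : OpenPartialHomeomorph M H} (hφ : φ ∈ IsManifold.maximalAtlas J ∞ M)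
    (hφ' : φ' ∈ IsManifold.maximalAtlas J ∞ M) (b b' : Module.Basis (Fin n) ℝ V)
    {A : Set M} (hA : MeasurableSet A) (hAs : A ⊆ φ.source) (hAs' : A ⊆ φ'.source) :
    chartVolume Ω φ' b' A = chartVolume Ω φ b A := by
  have h := chartVolume_image Ω hφ hφ' b b' (F := id) mdifferentiable_id Function.injective_id
    (fun x v => by rw [mfderiv_id]; rfl) hA hAs (by simpa using hAs')
  rwa [Set.image_id] at h

lemma chartVolume_iUnion [J.Boundaryless] [MeasurableSpace M] [BorelSpace M]
    (Ω : (x : M) → TangentSpace J x [⋀^Fin n]→ₗ[ℝ] ℝ)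
    (φ : OpenPartialHomeomorph M H) (b : Module.Basis (Fin n) ℝ V)
    {A : ℕ → Set M} (hA : ∀ k, MeasurableSet (A k)) (hAs : ∀ k, A k ⊆ φ.source)
    (hd : Pairwise (Function.onFun Disjoint A)) :
    chartVolume Ω φ b (⋃ k, A k) = ∑' k, chartVolume Ω φ b (A k) := by
  unfold chartVolume
  rw [Set.image_iUnion]
  refine lintegral_iUnion (fun k => measurableSet_extend_image φ (hA k) (hAs k)) ?_ _
  intro i j hij
  have hs : ∀ k, A k ⊆ (φ.extend J).source := by simpa only [φ.extend_source] using hAs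
  exact (hd hij).image (φ.extend J).injOn (hs i) (hs j)

/-- The measure on the domain of a chart with density `|Ω|`. -/
def chartMeasure [MeasurableSpace M] (Ω : (x : M) → TangentSpace J x [⋀^Fin n]→ₗ[ℝ] ℝ)
    (φ : OpenPartialHomeomorph M H) (b : Module.Basis (Fin n) ℝ V) : Measure M :=
  ((b.addHaar.withDensity (formDensity Ω φ b)).restrict (φ.extend J).target).map
    (φ.extend J).symm

lemma chartMeasure_apply [J.Boundaryless] [MeasurableSpace M] [BorelSpace M]
    (Ω : (x : M) → TangentSpace J x [⋀^Fin n]→ₗ[ℝ] ℝ)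
    (φ : OpenPartialHomeomorph M H) (b : Module.Basis (Fin n) ℝ V) {A : Set M}
    (hA : MeasurableSet A) (hAs : A ⊆ φ.source) :
    chartMeasure Ω φ b A = chartVolume Ω φ b A := by
  have ht := (φ.isOpen_extend_target (I := J)).measurableSet
  have hs : A ⊆ (φ.extend J).source := by rwa [φ.extend_source]
  rw [chartMeasure, Measure.map_apply_of_aemeasurable
    ((φ.continuousOn_extend_symm).aemeasurable ht) hA, Measure.restrict_apply' ht, Set.inter_comm,
    ← (φ.extend J).image_eq_target_inter_inv_preimage hs,
    withDensity_apply _ (measurableSet_extend_image φ hA hAs)]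
  rfl

/-- Existence of the measure induced by a top-degree form. -/
theorem exists_isFormMeasure [J.Boundaryless] [IsManifold J ∞ M] [MeasurableSpace M]
    [BorelSpace M] [SecondCountableTopology M] [Nonempty M]
    (Ω : (x : M) → TangentSpace J x [⋀^Fin n]→ₗ[ℝ] ℝ) (b : Module.Basis (Fin n) ℝ V) :
    ∃ ν : Measure M, IsFormMeasure J Ω ν := by
  obtain ⟨s, hs, hsU⟩ := TopologicalSpace.countable_cover_nhds
    (f := fun x : M => (chartAt H x).source) (fun x => chart_source_mem_nhds H x)
  have hne : s.Nonempty := by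
    rw [Set.nonempty_iff_ne_empty]
    rintro rfl
    exact Set.empty_ne_univ (by simpa using hsU)
  obtain ⟨x, rfl⟩ := hs.exists_eq_range hne
  set φ : ℕ → OpenPartialHomeomorph M H := fun k => chartAt H (x k)
  have hφ : ∀ k, φ k ∈ IsManifold.maximalAtlas J ∞ M := fun k =>
    IsManifold.chart_mem_maximalAtlas (x k)
  set D : ℕ → Set M := disjointed fun k => (φ k).source
  have hDm : ∀ k, MeasurableSet (D k) :=
    fun k => MeasurableSet.disjointed (fun i => (φ i).open_source.measurableSet) k
  have hDs : ∀ k, D k ⊆ (φ k).source := fun k => disjointed_subset _ k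
  have hDu : ⋃ k, D k = Set.univ := by
    rw [iUnion_disjointed, ← hsU, Set.biUnion_range]
  refine ⟨Measure.sum fun k => (chartMeasure Ω (φ k) b).restrict (D k), ?_⟩
  intro ψ hψ b' A hA hAs
  rw [Measure.sum_apply _ hA]
  have hk : ∀ k, (chartMeasure Ω (φ k) b).restrict (D k) A = chartVolume Ω ψ b' (A ∩ D k) := by
    intro k
    rw [Measure.restrict_apply hA, chartMeasure_apply Ω _ b (hA.inter (hDm k))
      (Set.inter_subset_right.trans (hDs k))]
    exact chartVolume_eq Ω hψ (hφ k) b' b (hA.inter (hDm k))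
      (Set.inter_subset_left.trans hAs) (Set.inter_subset_right.trans (hDs k))
  simp only [hk]
  rw [← chartVolume_iUnion Ω ψ b' (fun k => hA.inter (hDm k))
    (fun k => Set.inter_subset_left.trans hAs), ← Set.inter_iUnion, hDu, Set.inter_univ]
  · rfl
  · intro i j hij
    exact (disjoint_disjointed _ hij).mono Set.inter_subset_right Set.inter_subset_right

/-- Uniqueness of the measure induced by a top-degree form. -/
theorem IsFormMeasure.unique [IsManifold J ∞ M] [MeasurableSpace M]
    [BorelSpace M] [SecondCountableTopology M]
    {Ω : (x : M) → TangentSpace J x [⋀^Fin n]→ₗ[ℝ] ℝ} (b : Module.Basis (Fin n) ℝ V)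
    {μ ν : Measure M} (hμ : IsFormMeasure J Ω μ) (hν : IsFormMeasure J Ω ν) : μ = ν := by
  refine measure_ext_of_nhds fun x => ⟨(chartAt H x).source, (chartAt H x).open_source,
    mem_chart_source H x, fun A hA hAs => ?_⟩
  have hφ := IsManifold.chart_mem_maximalAtlas (I := J) (n := ∞) x
  rw [hμ _ hφ b A hA hAs, hν _ hφ b A hA hAs]

/-- A diffeomorphism that preserves `|Ω|` preserves the measure induced by `Ω`. -/
theorem IsFormMeasure.map_symm_eq [J.Boundaryless] [IsManifold J ∞ M] [MeasurableSpace M]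
    [BorelSpace M] [SecondCountableTopology M]
    {Ω : (x : M) → TangentSpace J x [⋀^Fin n]→ₗ[ℝ] ℝ} (b : Module.Basis (Fin n) ℝ V)
    {ν : Measure M} (hν : IsFormMeasure J Ω ν) (F : M ≃ₜ M) (hF : MDifferentiable J J F)
    (hΩ : ∀ (x : M) (v : Fin n → TangentSpace J x),
      |Ω (F x) (fun i => mfderiv J J F x (v i))| = |Ω x v|) :
    ν.map F.symm = ν := by
  refine measure_ext_of_nhds fun x => ⟨(chartAt H x).source ∩ F ⁻¹' (chartAt H (F x)).source,
    (chartAt H x).open_source.inter ((chartAt H (F x)).open_source.preimage F.continuous),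
    ⟨mem_chart_source H x, mem_chart_source H (F x)⟩, fun A hA hAs => ?_⟩
  have hφ := IsManifold.chart_mem_maximalAtlas (I := J) (n := ∞) x
  have hφ' := IsManifold.chart_mem_maximalAtlas (I := J) (n := ∞) (F x)
  have hFA : MeasurableSet (F '' A) := F.toMeasurableEquiv.measurableSet_image.2 hA
  have hs : F '' A ⊆ (chartAt H (F x)).source := by
    rintro _ ⟨z, hz, rfl⟩; exact (hAs hz).2
  rw [Measure.map_apply F.symm.continuous.measurable hA, ← F.image_eq_preimage_symm,
    hν _ hφ b A hA (hAs.trans Set.inter_subset_left), hν _ hφ' b _ hFA hs]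
  exact chartVolume_image Ω hφ hφ' b b hF F.injective hΩ hA (hAs.trans Set.inter_subset_left) hs

end FormMeasure

section Homogeneous

variable {n : ℕ} {V : Type*} [NormedAddCommGroup V] [NormedSpace ℝ V]
    [MeasurableSpace V] [BorelSpace V] {H : Type*} [TopologicalSpace H]
    {J : ModelWithCorners ℝ V H} {M : Type*} [TopologicalSpace M] [ChartedSpace H M]

/-- Where the density is continuous and nonzero, the measure is locally finite and nonzero. -/
theorem IsFormMeasure.exists_nhds_pos_lt_top [J.Boundaryless] [IsManifold J ∞ M]
    [MeasurableSpace M] [BorelSpace M] {Ω : (x : M) → TangentSpace J x [⋀^Fin n]→ₗ[ℝ] ℝ}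
    (b : Module.Basis (Fin n) ℝ V) {ν : Measure M} (hν : IsFormMeasure J Ω ν) (x : M)
    (hc : ContinuousAt (formDensity Ω (chartAt H x) b) (extChartAt J x x))
    (h0 : formDensity Ω (chartAt H x) b (extChartAt J x x) ≠ 0) :
    ∃ U : Set M, IsOpen U ∧ x ∈ U ∧ ν U ≠ 0 ∧ ν U < ⊤ := by
  have : FiniteDimensional ℝ V := b.finiteDimensional_of_finite
  have : ProperSpace V := FiniteDimensional.proper_real V
  set e := extChartAt J x with he
  set d := formDensity Ω (chartAt H x) b (e x) with hd
  have hdt : d ≠ ⊤ := ENNReal.ofReal_ne_top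
  have hlow : d / 2 < d := ENNReal.half_lt_self h0 hdt
  have hup : d < d + 1 := ENNReal.lt_add_right hdt one_ne_zero
  have hev := hc.eventually (Ioo_mem_nhds hlow hup)
  have htgt : e.target ∈ nhds (e x) := extChartAt_target_mem_nhds x
  obtain ⟨r, hr, hball⟩ := Metric.mem_nhds_iff.1 (Filter.inter_mem hev htgt)
  set N := Metric.ball (e x) r
  have hNt : N ⊆ e.target := fun y hy => (hball hy).2
  have hU : IsOpen (e.source ∩ e ⁻¹' N) :=
    (continuousOn_extChartAt x).isOpen_inter_preimage (isOpen_extChartAt_source x)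
      Metric.isOpen_ball
  have himg : e '' (e.source ∩ e ⁻¹' N) = N := by
    ext y
    constructor
    · rintro ⟨z, hz, rfl⟩
      exact hz.2
    · intro hy
      refine ⟨e.symm y, ⟨e.map_target (hNt hy), ?_⟩, e.right_inv (hNt hy)⟩
      change e (e.symm y) ∈ N
      rwa [e.right_inv (hNt hy)]
  have hval : ν (e.source ∩ e ⁻¹' N) = ∫⁻ y in N, formDensity Ω (chartAt H x) b y ∂b.addHaar := by
    rw [hν _ (IsManifold.chart_mem_maximalAtlas x) b _ hU.measurableSet
      (by rw [← extChartAt_source J]; exact Set.inter_subset_left)]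
    change ∫⁻ y in e '' (e.source ∩ e ⁻¹' N), formDensity Ω (chartAt H x) b y ∂b.addHaar = _
    rw [himg]
  have hNpos : b.addHaar N ≠ 0 := (Metric.measure_ball_pos _ _ hr).ne'
  have hNfin : b.addHaar N < ⊤ := measure_ball_lt_top
  refine ⟨e.source ∩ e ⁻¹' N, hU, ⟨mem_extChartAt_source x, Metric.mem_ball_self hr⟩, ?_, ?_⟩
  · rw [hval]
    have : d / 2 * b.addHaar N ≤ ∫⁻ y in N, formDensity Ω (chartAt H x) b y ∂b.addHaar := by
      rw [← setLIntegral_const]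
      exact setLIntegral_mono' Metric.isOpen_ball.measurableSet fun y hy => (hball hy).1.1.le
    refine (lt_of_lt_of_le ?_ this).ne'
    exact ENNReal.mul_pos (ENNReal.half_pos h0).ne' hNpos
  · rw [hval]
    have : ∫⁻ y in N, formDensity Ω (chartAt H x) b y ∂b.addHaar ≤ (d + 1) * b.addHaar N := by
      rw [← setLIntegral_const]
      exact setLIntegral_mono' Metric.isOpen_ball.measurableSet fun y hy => (hball hy).1.2.le
    exact this.trans_lt (ENNReal.mul_lt_top (by simpa using hdt.lt_top) hNfin)

/-- A form that is, up to sign, pulled back from a fixed point by maps `τ p` is invariant under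
every map that is compatible with `τ`. -/
lemma abs_form_comp_mfderiv {Ω : (x : M) → TangentSpace J x [⋀^Fin n]→ₗ[ℝ] ℝ}
    {W : V [⋀^Fin n]→ₗ[ℝ] ℝ} {τ : M → M → M} (hτ : ∀ p, MDifferentiable J J (τ p))
    (hΩ : ∀ p (v : Fin n → V), |Ω p v| = |W fun i => (mfderiv J J (τ p) p : V →L[ℝ] V) (v i)|)
    {F : M → M} (hF : MDifferentiable J J F) (hFτ : ∀ p q, τ (F p) (F q) = τ p q)
    (x : M) (v : Fin n → TangentSpace J x) :
    |Ω (F x) (fun i => mfderiv J J F x (v i))| = |Ω x v| := by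
  refine (hΩ (F x) _).trans (Eq.trans ?_ (hΩ x v).symm)
  have h : (τ (F x)) ∘ F = τ x := funext fun q => hFτ x q
  have h1 := mfderiv_comp x (hτ (F x) (F x)) (hF x)
  rw [h] at h1
  refine congrArg (fun u => |W u|) (funext fun i => ?_)
  exact (congrArg (fun f : V →L[ℝ] V => f (v i)) h1).symm

theorem continuousAt_formDensity [J.Boundaryless] [IsManifold J ∞ M]
    {Ω : (x : M) → TangentSpace J x [⋀^Fin n]→ₗ[ℝ] ℝ}
    {W : V [⋀^Fin n]→ₗ[ℝ] ℝ} (hW : W ≠ 0) {τ : M → M → M} {o : M} (ho : ∀ p, τ p p = o)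
    (hτ : ContMDiff (J.prod J) J ∞ (Function.uncurry τ))
    (hinv : ∀ p, ∃ σ : M → M, MDifferentiable J J σ ∧ ∀ q, σ (τ p q) = q)
    (hΩ : ∀ p (v : Fin n → V), |Ω p v| = |W fun i => (mfderiv J J (τ p) p : V →L[ℝ] V) (v i)|)
    (b : Module.Basis (Fin n) ℝ V) (x : M) :
    ContinuousAt (formDensity Ω (chartAt H x) b) (extChartAt J x x) ∧
      formDensity Ω (chartAt H x) b (extChartAt J x x) ≠ 0 := by
  have : IsManifold J 1 M := IsManifold.of_le (n := ∞) (by simp)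
  set e := extChartAt J x with he
  have hoo : ∀ p, τ p p = τ x x := fun p => (ho p).trans (ho x).symm
  let K : M → V →L[ℝ] V := inTangentCoordinates J J id (fun p => τ p p)
    (fun p => mfderiv J J (τ p) p) x
  have hK : ContinuousAt K x :=
    (ContMDiffAt.mfderiv (m := 0) (n := ∞) τ id hτ.contMDiffAt contMDiffAt_id
      (by simp)).continuousAt
  have hKe : ∀ y ∈ e.target, ∀ v, K (e.symm y) v =
      (mfderiv J J (τ (e.symm y)) (e.symm y) : V →L[ℝ] V)
        ((mfderiv 𝓘(ℝ, V) J e.symm y : V →L[ℝ] V) v) := by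
    intro y hy v
    have hs : e.symm y ∈ (chartAt H x).source := by
      rw [← extChartAt_source J]; exact e.map_target hy
    have h1 := inTangentCoordinates_eq_mfderiv_comp (I := J) (I' := J) (f := id)
      (g := fun p => τ p p) (ϕ := fun p => mfderiv J J (τ p) p) (x₀ := x) (x := e.symm y) hs
      (by simp only [hoo (e.symm y)]; exact mem_chart_source H _)
    have h2 : ∀ z, z = τ x x → ∀ w : V,
        (mfderiv J 𝓘(ℝ, V) (extChartAt J (τ x x)) z : V →L[ℝ] V) w = w := by
      rintro z rfl w
      have h : mfderiv J 𝓘(ℝ, V) (extChartAt J (τ x x)) (τ x x) =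
          tangentCoordChange J (τ x x) (τ x x) (τ x x) :=
        (mdifferentiableAt_extChartAt (mem_chart_source H _)).mfderiv
      exact (congrArg (fun f : V →L[ℝ] V => f w) h).trans
        (tangentCoordChange_self (mem_extChartAt_source _))
    have h3 := congrArg (fun f : V →L[ℝ] V => f v) h1
    refine h3.trans ?_
    refine (h2 _ (hoo _) _).trans ?_
    have h4 : e (e.symm y) = y := e.right_inv hy
    simp only [id, J.range_eq_univ, mfderivWithin_univ]
    rw [← he, h4]
    rfl
  have hdens : ∀ y ∈ e.target, formDensity Ω (chartAt H x) b y =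
      ENNReal.ofReal |(K (e.symm y)).det * W b| := by
    intro y hy
    refine congrArg ENNReal.ofReal ?_
    refine (hΩ _ _).trans ?_
    rw [ContinuousLinearMap.det, ← alternatingMap_comp_linearMap b W]
    refine congrArg (fun u => |W u|) (funext fun i => ?_)
    exact (hKe y hy (b i)).symm
  have htgt : e.target ∈ nhds (e x) := extChartAt_target_mem_nhds x
  have hxe : e.symm (e x) = x := extChartAt_to_inv x
  constructor
  · have hcont : ContinuousAt (fun y => ENNReal.ofReal |(K (e.symm y)).det * W b|) (e x) := by
      have h1 : ContinuousAt (fun y => K (e.symm y)) (e x) := by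
        refine ContinuousAt.comp (g := K) ?_ (continuousAt_extChartAt_symm x)
        rwa [hxe]
      have h2 := (ContinuousLinearMap.continuous_det (E := V)).continuousAt.comp h1
      exact ENNReal.continuous_ofReal.continuousAt.comp (h2.mul continuousAt_const).abs
    refine hcont.congr ?_
    filter_upwards [htgt] with y hy
    exact (hdens y hy).symm
  · have hxt : e x ∈ e.target := mem_of_mem_nhds htgt
    rw [hdens _ hxt]
    have hWb : W b ≠ 0 := (AlternatingMap.map_basis_ne_zero_iff b W).2 hW
    have hdet : (K (e.symm (e x))).det ≠ 0 := by
      obtain ⟨σ, hσ, hσx⟩ := hinv x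
      have hx : x ∈ (chartAt H x).source := mem_chart_source H x
      set B : V →L[ℝ] V := mfderiv 𝓘(ℝ, V) J e.symm (e x)
      set B' : V →L[ℝ] V := mfderiv J 𝓘(ℝ, V) e x
      set C : V →L[ℝ] V := mfderiv J J (τ x) x
      set C' : V →L[ℝ] V := mfderiv J J σ (τ x x)
      have hB : B ∘L B' = ContinuousLinearMap.id ℝ V :=
        mfderiv_extend_symm_comp (IsManifold.chart_mem_maximalAtlas x) hx
      have hC : C' ∘L C = ContinuousLinearMap.id ℝ V := by
        have hτx : MDifferentiableAt J J (τ x) x := by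
          have : ContMDiff J J ∞ (τ x) := hτ.comp (contMDiff_const.prodMk contMDiff_id)
          exact (this.mdifferentiable (by simp)) x
        have h1 := mfderiv_comp x (hσ (τ x x)) hτx
        refine h1.symm.trans ?_
        rw [show σ ∘ τ x = id from funext hσx]
        exact mfderiv_id
      have hKx : K (e.symm (e x)) = C ∘L B := by
        have hz : ∀ z, z = x → ∀ w, (mfderiv J J (τ z) z : V →L[ℝ] V) w = C w := by
          rintro _ rfl w; rfl
        ext v
        exact (hKe _ hxt v).trans (hz _ hxe _)
      have hdc : ∀ A B : V →L[ℝ] V, (A ∘L B).det = A.det * B.det :=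
        fun A B => LinearMap.det_comp _ _
      have hid : (ContinuousLinearMap.id ℝ V).det = 1 := LinearMap.det_id
      have hBd := congrArg ContinuousLinearMap.det hB
      have hCd := congrArg ContinuousLinearMap.det hC
      rw [hdc, hid] at hBd hCd
      rw [hKx, hdc]
      exact mul_ne_zero (right_ne_zero_of_mul_eq_one hCd) (left_ne_zero_of_mul_eq_one hBd)
    exact (ENNReal.ofReal_pos.2 (abs_pos.2 (mul_ne_zero hdet hWb))).ne'

end Homogeneous

section Invariant

/-- Uniqueness of translation invariant measures on the product of a group and a vector space. -/
theorem exists_prod_eq_smul_of_invariant {G E : Type*} [TopologicalSpace G] [T2Space G]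
    [SecondCountableTopology G] [LocallyCompactSpace G] [Group G] [IsTopologicalGroup G]
    [MeasurableSpace G] [BorelSpace G] [NormedAddCommGroup E] [NormedSpace ℝ E]
    [FiniteDimensional ℝ E] [MeasurableSpace E] [BorelSpace E]
    (haar : Measure G) [haar.IsHaarMeasure] (leb : Measure E) [leb.IsAddHaarMeasure]
    (ν : Measure (G × E)) [IsFiniteMeasureOnCompacts ν] (hν : ν ≠ 0)
    (hmul : ∀ h : G, ν.map (fun p => (h * p.1, p.2)) = ν)
    (hadd : ∀ η : E, ν.map (fun p => (p.1, η + p.2)) = ν) :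
    ∃ c : ℝ≥0, 0 < c ∧ haar.prod leb = c • ν := by
  have : ProperSpace E := FiniteDimensional.proper_real E
  set B : Set E := Metric.closedBall 0 1
  have hBc : IsCompact B := isCompact_closedBall 0 1
  have hBm : MeasurableSet B := hBc.measurableSet
  have hB0 : leb B ≠ 0 := (Metric.measure_closedBall_pos leb 0 one_pos).ne'
  have hBt : leb B ≠ ⊤ := hBc.measure_lt_top.ne
  have hmul' : ∀ (h : G) (A : Set G) (T : Set E), MeasurableSet A → MeasurableSet T →
      ν (((fun x => h * x) ⁻¹' A) ×ˢ T) = ν (A ×ˢ T) := by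
    intro h A T hA hT
    conv_rhs => rw [← hmul h]
    rw [Measure.map_apply (by fun_prop) (hA.prod hT)]
    rfl
  have hadd' : ∀ (η : E) (A : Set G) (T : Set E), MeasurableSet A → MeasurableSet T →
      ν (A ×ˢ ((fun x => η + x) ⁻¹' T)) = ν (A ×ˢ T) := by
    intro η A T hA hT
    conv_rhs => rw [← hadd η]
    rw [Measure.map_apply (by fun_prop) (hA.prod hT)]
    rfl
  obtain ⟨c, hc⟩ : ∃ c : ℝ≥0, ∀ A, MeasurableSet A → ν (A ×ˢ B) = c * haar A := by
    set κ : Measure G := (ν.restrict (Set.univ ×ˢ B)).map Prod.fst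
    have hκ : ∀ A, MeasurableSet A → κ A = ν (A ×ˢ B) := by
      intro A hA
      rw [Measure.map_apply measurable_fst hA, Measure.restrict_apply (measurable_fst hA)]
      congr 1
      ext p; simp
    have : IsFiniteMeasureOnCompacts κ :=
      ⟨fun K hK => by rw [hκ K hK.measurableSet]; exact (hK.prod hBc).measure_lt_top⟩
    have : κ.IsMulLeftInvariant := ⟨fun h => by
      ext A hA
      rw [Measure.map_apply (by fun_prop) hA, hκ _ (measurable_const_mul h hA), hκ A hA,
        hmul' h A B hA hBm]⟩
    refine ⟨κ.haarScalarFactor haar, fun A hA => ?_⟩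
    rw [← hκ A hA]
    conv_lhs => rw [Measure.isMulLeftInvariant_eq_smul κ haar]
    rfl
  have hrel : ∀ (A K : Set G) (T : Set E), MeasurableSet A → IsCompact K → A ⊆ K →
      MeasurableSet T → ν (A ×ˢ T) = (c / leb B) * haar A * leb T := by
    intro A K T hA hK hAK hT
    set κ : Measure E := (ν.restrict (A ×ˢ Set.univ)).map Prod.snd
    have hκ : ∀ T, MeasurableSet T → κ T = ν (A ×ˢ T) := by
      intro T hT
      rw [Measure.map_apply measurable_snd hT, Measure.restrict_apply (measurable_snd hT)]
      congr 1
      ext p; simp [and_comm]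
    have : IsFiniteMeasureOnCompacts κ :=
      ⟨fun S hS => by
        rw [hκ S hS.measurableSet]
        exact (measure_mono (Set.prod_mono_left hAK)).trans_lt (hK.prod hS).measure_lt_top⟩
    have : κ.IsAddLeftInvariant := ⟨fun η => by
      ext S hS
      rw [Measure.map_apply (by fun_prop) hS, hκ _ (measurable_const_add η hS), hκ S hS,
        hadd' η A S hA hS]⟩
    have hs : ∀ S, κ S = κ.addHaarScalarFactor leb * leb S := fun S => by
      conv_lhs => rw [Measure.isAddLeftInvariant_eq_smul κ leb]
      rfl
    have h1 := hs B
    rw [hκ B hBm, hc A hA] at h1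
    rw [← hκ T hT, hs T]
    congr 1
    rw [ENNReal.div_eq_inv_mul, mul_assoc, h1, mul_comm (_ : ℝ≥0∞) (leb B), ← mul_assoc,
      ENNReal.inv_mul_cancel hB0 hBt, one_mul]
  have hall : ∀ (A : Set G) (T : Set E), MeasurableSet A → MeasurableSet T →
      ν (A ×ˢ T) = (c / leb B) * haar A * leb T := by
    intro A T hA hT
    have hcov : A = ⋃ k, A ∩ compactCovering G k := by
      rw [← Set.inter_iUnion, iUnion_compactCovering, Set.inter_univ]
    have hmono : Monotone fun k => A ∩ compactCovering G k := fun i j hij =>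
      Set.inter_subset_inter_right _ (compactCovering_subset G hij)
    have hmono' : Monotone fun k => (A ∩ compactCovering G k) ×ˢ T := fun i j hij =>
      Set.prod_mono_left (hmono hij)
    have h1 : ν (A ×ˢ T) = ⨆ k, ν ((A ∩ compactCovering G k) ×ˢ T) := by
      rw [← hmono'.measure_iUnion, ← Set.iUnion_prod_const, ← hcov]
    have h2 : haar A = ⨆ k, haar (A ∩ compactCovering G k) := by
      rw [← hmono.measure_iUnion, ← hcov]
    rw [h1, h2, ENNReal.mul_iSup, ENNReal.iSup_mul]
    refine iSup_congr fun k => ?_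
    exact hrel _ _ T (hA.inter (isCompact_compactCovering G k).measurableSet)
      (isCompact_compactCovering G k) Set.inter_subset_right hT
  have hct : (c / leb B : ℝ≥0∞) ≠ ⊤ := (ENNReal.div_lt_top ENNReal.coe_ne_top hB0).ne
  obtain ⟨c', hc'⟩ : ∃ c' : ℝ≥0, (c' : ℝ≥0∞) = c / leb B := ⟨_, ENNReal.coe_toNNReal hct⟩
  have hprod : (c' • haar).prod leb = ν := by
    refine Measure.prod_eq fun A T hA hT => ?_
    rw [hall A T hA hT, ← hc']
    rfl
  have hc0 : c' ≠ 0 := by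
    rintro rfl
    rw [zero_smul, Measure.zero_prod] at hprod
    exact hν hprod.symm
  refine ⟨c'⁻¹, inv_pos.2 (pos_iff_ne_zero.2 hc0), ?_⟩
  rw [← hprod]
  refine Measure.prod_eq fun A T hA hT => ?_
  rw [Measure.smul_apply, Measure.prod_prod, Measure.smul_apply, ENNReal.smul_def,
    ENNReal.smul_def, smul_eq_mul, smul_eq_mul, ← mul_assoc, ← mul_assoc, ← ENNReal.coe_mul,
    inv_mul_cancel₀ hc0, ENNReal.coe_one, one_mul]

end Invariant

section Symplectic

variable {m : ℕ} {G : Type*} [TopologicalSpace G] [ChartedSpace (EuclideanSpace ℝ (Fin m)) G]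
  [Group G] [LieGroup (𝓡 m) ∞ G]

/-- The translation of `G × 𝔤` that takes `p` to the identity element. -/
def translateToOne (p q : G × GroupLieAlgebra (𝓡 m) G) : G × GroupLieAlgebra (𝓡 m) G :=
  (p.1⁻¹ * q.1, q.2 - p.2)

lemma contMDiff_translateToOne :
    ContMDiff (((𝓡 m).prod 𝓘(ℝ, GroupLieAlgebra (𝓡 m) G)).prod
      ((𝓡 m).prod 𝓘(ℝ, GroupLieAlgebra (𝓡 m) G))) ((𝓡 m).prod 𝓘(ℝ, GroupLieAlgebra (𝓡 m) G)) ∞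
      (Function.uncurry (translateToOne (m := m) (G := G))) := by
  have h1 : ContMDiff (((𝓡 m).prod 𝓘(ℝ, GroupLieAlgebra (𝓡 m) G)).prod
      ((𝓡 m).prod 𝓘(ℝ, GroupLieAlgebra (𝓡 m) G))) (𝓡 m) ∞
      (fun x : (G × GroupLieAlgebra (𝓡 m) G) × (G × GroupLieAlgebra (𝓡 m) G) =>
        x.1.1⁻¹ * x.2.1) :=
    ((contMDiff_fst.comp contMDiff_fst).inv).mul (contMDiff_fst.comp contMDiff_snd)
  have h2 : ContMDiff (((𝓡 m).prod 𝓘(ℝ, GroupLieAlgebra (𝓡 m) G)).prod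
      ((𝓡 m).prod 𝓘(ℝ, GroupLieAlgebra (𝓡 m) G))) 𝓘(ℝ, GroupLieAlgebra (𝓡 m) G) ∞
      (fun x : (G × GroupLieAlgebra (𝓡 m) G) × (G × GroupLieAlgebra (𝓡 m) G) =>
        x.2.2 - x.1.2) :=
    (contMDiff_snd.comp contMDiff_snd).sub (contMDiff_snd.comp contMDiff_fst)
  exact h1.prodMk h2

lemma mdifferentiable_leftTranslate (h : G) :
    MDifferentiable (𝓡 m) (𝓡 m) (fun x : G => h * x) :=
  (contMDiff_mul_left (I := 𝓡 m) (n := ∞)).mdifferentiable (by simp)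

lemma mdifferentiable_addTranslate (η : GroupLieAlgebra (𝓡 m) G) :
    MDifferentiable 𝓘(ℝ, GroupLieAlgebra (𝓡 m) G) 𝓘(ℝ, GroupLieAlgebra (𝓡 m) G)
      (fun x => x + η) :=
  (differentiable_id.add_const η).mdifferentiable

lemma mfderiv_translateToOne (p : G × GroupLieAlgebra (𝓡 m) G)
    (v : TangentSpace ((𝓡 m).prod 𝓘(ℝ, GroupLieAlgebra (𝓡 m) G)) p) :
    mfderiv ((𝓡 m).prod 𝓘(ℝ, GroupLieAlgebra (𝓡 m) G))
      ((𝓡 m).prod 𝓘(ℝ, GroupLieAlgebra (𝓡 m) G)) (translateToOne p) p v =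
    leftTrivProd p v := by
  have h : translateToOne p = Prod.map (fun x : G => p.1⁻¹ * x)
      (fun x : GroupLieAlgebra (𝓡 m) G => x + -p.2) := by
    funext q; exact Prod.ext rfl (sub_eq_add_neg _ _)
  have h1 := mfderiv_prodMap (p := p) (mdifferentiable_leftTranslate (m := m) p.1⁻¹ p.1)
    (mdifferentiable_addTranslate (m := m) (G := G) (-p.2) p.2)
  rw [h]
  refine (congrArg (fun f : (EuclideanSpace ℝ (Fin m) × GroupLieAlgebra (𝓡 m) G) →L[ℝ]
    (EuclideanSpace ℝ (Fin m) × GroupLieAlgebra (𝓡 m) G) => f v) h1).trans ?_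
  have h2 : mfderiv 𝓘(ℝ, GroupLieAlgebra (𝓡 m) G) 𝓘(ℝ, GroupLieAlgebra (𝓡 m) G)
      (fun x => x + -p.2) p.2 = ContinuousLinearMap.id ℝ (GroupLieAlgebra (𝓡 m) G) := by
    rw [mfderiv_eq_fderiv]
    exact ((hasFDerivAt_id p.2).add_const (-p.2)).fderiv
  refine Prod.ext rfl ?_
  exact congrArg (fun f : GroupLieAlgebra (𝓡 m) G →L[ℝ] GroupLieAlgebra (𝓡 m) G => f v.2) h2

lemma finrank_groupLieAlgebra : Module.finrank ℝ (GroupLieAlgebra (𝓡 m) G) = m :=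
  finrank_euclideanSpace_fin

/-- The Liouville form is, up to sign, pulled back from the identity by translations. -/
lemma abs_wedgePow_symplecticForm (ip : InnerProductSpace.Core ℝ (GroupLieAlgebra (𝓡 m) G))
    (p : G × GroupLieAlgebra (𝓡 m) G)
    (v : Fin (2 * m) → EuclideanSpace ℝ (Fin m) × GroupLieAlgebra (𝓡 m) G) :
    |wedgePow (symplecticForm ip p) m v| = |wedgePow (trivializedForm ip 0) m fun i =>
      (mfderiv ((𝓡 m).prod 𝓘(ℝ, GroupLieAlgebra (𝓡 m) G))
        ((𝓡 m).prod 𝓘(ℝ, GroupLieAlgebra (𝓡 m) G)) (translateToOne p) p :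
        EuclideanSpace ℝ (Fin m) × GroupLieAlgebra (𝓡 m) G →L[ℝ]
          EuclideanSpace ℝ (Fin m) × GroupLieAlgebra (𝓡 m) G) (v i)| := by
  unfold symplecticForm
  rw [wedgePow_compLinearMap]
  refine (abs_wedgePow_trivializedForm ip p.2 finrank_groupLieAlgebra _).trans ?_
  refine congrArg (fun u => |wedgePow (trivializedForm ip 0) m u|) (funext fun i => ?_)
  exact (mfderiv_translateToOne p (v i)).symm

end Symplectic

end LieVolume
end

theorem mainTheorem8 {m : ℕ} {G : Type*} [TopologicalSpace G] [T2Space G]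
    [SecondCountableTopology G] [ChartedSpace (EuclideanSpace ℝ (Fin m)) G] [Group G]
    [LieGroup (𝓡 m) ∞ G] [MeasurableSpace G] [BorelSpace G]
    (ip : InnerProductSpace.Core ℝ (GroupLieAlgebra (𝓡 m) G))
    (haar : Measure G) [haar.IsHaarMeasure]
    (leb : Measure (GroupLieAlgebra (𝓡 m) G)) [leb.IsAddHaarMeasure] :
    (∃! ν : Measure (G × GroupLieAlgebra (𝓡 m) G),
      LieVolume.IsFormMeasure ((𝓡 m).prod 𝓘(ℝ, GroupLieAlgebra (𝓡 m) G))
        (fun p => LieVolume.wedgePow (LieVolume.symplecticForm ip p) m) ν) ∧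
    ∃ c : ℝ≥0, 0 < c ∧ ∀ ν : Measure (G × GroupLieAlgebra (𝓡 m) G),
      LieVolume.IsFormMeasure ((𝓡 m).prod 𝓘(ℝ, GroupLieAlgebra (𝓡 m) G))
        (fun p => LieVolume.wedgePow (LieVolume.symplecticForm ip p) m) ν →
      haar.prod leb = c • ν := by
  open LieVolume in
  have b : Module.Basis (Fin (2 * m)) ℝ
      (EuclideanSpace ℝ (Fin m) × GroupLieAlgebra (𝓡 m) G) :=
    Module.finBasisOfFinrankEq ℝ _ (by
      rw [Module.finrank_prod, finrank_euclideanSpace_fin, finrank_groupLieAlgebra]; ring)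
  have : IsTopologicalGroup G := topologicalGroup_of_lieGroup (𝓡 m) ∞
  have : LocallyCompactSpace G := ChartedSpace.locallyCompactSpace (EuclideanSpace ℝ (Fin m)) G
  obtain ⟨ν, hν⟩ := exists_isFormMeasure (J := (𝓡 m).prod 𝓘(ℝ, GroupLieAlgebra (𝓡 m) G))
    (M := G × GroupLieAlgebra (𝓡 m) G) (fun p => wedgePow (symplecticForm ip p) m) b
  have huniq := fun ν' (hν' : IsFormMeasure ((𝓡 m).prod 𝓘(ℝ, GroupLieAlgebra (𝓡 m) G))
    (fun p : G × GroupLieAlgebra (𝓡 m) G => wedgePow (symplecticForm ip p) m) ν') =>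
    hν'.unique b hν
  refine ⟨⟨ν, hν, huniq⟩, ?_⟩
  have hΩ := abs_wedgePow_symplecticForm (m := m) (G := G) ip
  have hτ := contMDiff_translateToOne (m := m) (G := G)
  have hτp : ∀ p : G × GroupLieAlgebra (𝓡 m) G,
      MDifferentiable ((𝓡 m).prod 𝓘(ℝ, GroupLieAlgebra (𝓡 m) G))
        ((𝓡 m).prod 𝓘(ℝ, GroupLieAlgebra (𝓡 m) G)) (translateToOne p) := fun p =>
    ContMDiff.mdifferentiable (hτ.comp (contMDiff_const.prodMk contMDiff_id)) (n := ∞) (by simp)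
  have hmul : ∀ h : G, ν.map (fun p => (h * p.1, p.2)) = ν := by
    intro h
    have := hν.map_symm_eq b ((Homeomorph.mulLeft h⁻¹).prodCongr (Homeomorph.refl _))
      ((mdifferentiable_leftTranslate (m := m) h⁻¹).prodMap mdifferentiable_id)
      (abs_form_comp_mfderiv hτp hΩ
        ((mdifferentiable_leftTranslate (m := m) h⁻¹).prodMap mdifferentiable_id)
        (fun p q => by simp [translateToOne]))
    convert! this using 2
    funext p
    exact Prod.ext (show h * p.1 = h⁻¹⁻¹ * p.1 by rw [inv_inv]) rfl
  have hadd : ∀ η : GroupLieAlgebra (𝓡 m) G, ν.map (fun p => (p.1, η + p.2)) = ν := by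
    intro η
    have := hν.map_symm_eq b ((Homeomorph.refl G).prodCongr (Homeomorph.addRight (-η)))
      (mdifferentiable_id.prodMap (mdifferentiable_addTranslate (m := m) (G := G) (-η)))
      (abs_form_comp_mfderiv hτp hΩ
        (mdifferentiable_id.prodMap (mdifferentiable_addTranslate (m := m) (G := G) (-η)))
        (fun p q => by simp [translateToOne]))
    convert! this using 2
    funext p
    exact Prod.ext rfl (show η + p.2 = p.2 + - -η by rw [neg_neg, add_comm])
  have hloc : ∀ p : G × GroupLieAlgebra (𝓡 m) G, ∃ U : Set (G × GroupLieAlgebra (𝓡 m) G),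
      IsOpen U ∧ p ∈ U ∧ ν U ≠ 0 ∧ ν U < ⊤ := by
    intro p
    obtain ⟨h1, h2⟩ := continuousAt_formDensity
      (J := (𝓡 m).prod 𝓘(ℝ, GroupLieAlgebra (𝓡 m) G)) (M := G × GroupLieAlgebra (𝓡 m) G)
      (Ω := fun p => wedgePow (symplecticForm ip p) m)
      (wedgePow_trivializedForm_ne_zero ip finrank_groupLieAlgebra) (o := (1, 0))
      (fun p => by simp [translateToOne]) hτ
      (fun p => ⟨translateToOne (p.1⁻¹, -p.2), hτp _, fun q => by simp [translateToOne]⟩) hΩ b p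
    exact hν.exists_nhds_pos_lt_top b p h1 h2
  have : IsLocallyFiniteMeasure ν := ⟨fun p => by
    obtain ⟨U, hU, hp, -, hfin⟩ := hloc p
    exact ⟨U, hU.mem_nhds hp, hfin⟩⟩
  have hν0 : ν ≠ 0 := by
    rintro rfl
    obtain ⟨U, -, -, h0, -⟩ := hloc (1, 0)
    exact h0 rfl
  obtain ⟨c, hc, hcν⟩ := exists_prod_eq_smul_of_invariant haar leb ν hν0 hmul hadd
  exact ⟨c, hc, fun ν' hν' => by rw [huniq ν' hν', hcν]⟩
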